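/- Let $(W_t)_{t\ge 0}$ be a standard Brownian motion and let $\xi\ge 0$ (almost surely) be a real random variable independent of $W$. Let $$\tau=\inf\{t>0:\ \xi+W_t<0\}$$ be the first hitting time of the boundary with slope $k=0$ by the process $\xi+W_t$. Suppose that $\tau$ has a one-sided stable distribution with index $\alpha$, where $0<\alpha<1/2$, that is, for some $c>0$, $$\mathbb E\bigl[e^{-s\tau}\bigr]=e^{-c s^{\alpha}}\qquad\text{for all } s\ge 0 .$$ Then $\xi$ has a one-sided stable distribution with index $2\alpha$: its law is non-degenerate, carried by $[0,\infty)$, and for all $a,b>0$ and independent copies $\xi_1,\xi_2$ of $\xi$, the variable $a\xi_1+b\xi_2$ has the same distribution as $(a^{2\alpha}+b^{2\alpha})^{1/(2\alpha)}\,\xi$. Moreover, $$\mathbb E\bigl[e^{-s\xi}\bigr]=\exp\bigl(-c\,2^{-\alpha}s^{2\alpha}\bigr)\qquad\text{for all } s\ge 0 .$$ -/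

import Mathlib

open MeasureTheory ProbabilityTheory
open scoped NNReal ENNReal

/-- The first hitting time `inf {t > 0 : ξ + W_t < k t}` of the linear boundary `b(t) = k t` by the
process `X_t = ξ + W_t`, with the value `∞` if the boundary is never crossed. -/
noncomputable def firstHittingTime {Ω : Type*} (k : ℝ) (ξ : Ω → ℝ) (W : ℝ≥0 → Ω → ℝ) (ω : Ω) :
    ℝ≥0∞ :=
  ⨅ (t : ℝ≥0) (_ : 0 < t ∧ ξ ω + W t ω < k * (t : ℝ)), (t : ℝ≥0∞)

/-- `e^{-s t}` for a time `t ∈ [0, ∞]`, with the convention `e^{-s ∞} = 0`. -/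
noncomputable def expNegMul (s : ℝ) (t : ℝ≥0∞) : ℝ :=
  if t = ∞ then 0 else Real.exp (-s * t.toReal)

/-- `μ` is a (strictly) stable distribution of index `β` on the half-line `[0, ∞)`: it is a
non-degenerate probability measure carried by `[0, ∞)` such that, for independent `X₁, X₂` and `X`
with law `μ` and all `a, b > 0`, the variable `a X₁ + b X₂` has the law of
`(a ^ β + b ^ β) ^ (1 / β) X`. -/
structure IsOneSidedStable (μ : Measure ℝ) (β : ℝ) : Prop where
  isProbabilityMeasure : IsProbabilityMeasure μ
  nonneg : ∀ᵐ x ∂μ, 0 ≤ x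
  nondegenerate : ∀ x : ℝ, μ ≠ Measure.dirac x
  stable : ∀ a b : ℝ, 0 < a → 0 < b →
    (μ.prod μ).map (fun p : ℝ × ℝ => a * p.1 + b * p.2) =
      μ.map (fun x => (a ^ β + b ^ β) ^ (1 / β) * x)

/-! For `l ≥ 0` and `s = l ^ 2 / 2`, the process `exp (-l (ξ + W_t) - s t)` is a martingale with
initial value `exp (-l ξ)`. Up to `τ` it is at most one, because the path is nonnegative there, and
at a finite `τ` the path vanishes. Optional stopping thus gives `E exp (-s τ) = E exp (-l ξ)`
(`integral_expNegMul_firstHittingTime`), so `ξ` has Laplace transform `exp (-c 2 ^ (-α) l ^ (2 α))`.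
Uniqueness of Laplace transforms turns this into stability (`isOneSidedStable_of_integral_exp_neg`).

Optional stopping is proved by hand: the walk sampled on a grid of `[0, T]` is stopped at its first
negative value, the mesh tends to zero, then `T → ∞`. The sampled walk can overshoot below zero, so
its exponential is not bounded by one; an `L²` bound uniform in the mesh replaces domination. -/

/-! ### Laplace transforms and stability. -/

/-- Finite measures on `[0, ∞)` are determined by their Laplace transform at the integers. -/
theorem NNReal.measure_ext_of_integral_exp_neg {μ ν : Measure ℝ≥0} [IsFiniteMeasure μ]
    [IsFiniteMeasure ν]
    (h : ∀ n : ℕ, ∫ x : ℝ≥0, Real.exp (-n * x) ∂μ = ∫ x : ℝ≥0, Real.exp (-n * x) ∂ν) :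
    μ = ν := by
  let f : BoundedContinuousFunction ℝ≥0 ℝ :=
    BoundedContinuousFunction.ofNormedAddCommGroup (fun x : ℝ≥0 => Real.exp (-x)) (by fun_prop) 1
      (fun x => by simp [Real.norm_eq_abs, abs_of_pos (Real.exp_pos _)])
  have hf : ∀ x : ℝ≥0, f x = Real.exp (-x) := fun x => rfl
  -- Polynomials in `exp (-x)`: they separate points, and their integrals are combinations of
  -- Laplace transforms at integers.
  let A : StarSubalgebra ℝ (BoundedContinuousFunction ℝ≥0 ℝ) :=
    { (Polynomial.aeval (R := ℝ) f).range with
      star_mem' := by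
        intro g hg
        have : star g = g := by ext x; simp
        rw [this]; exact hg }
  have hmem : ∀ p : Polynomial ℝ, Polynomial.aeval f p ∈ A := fun p => ⟨p, rfl⟩
  have heval : ∀ (p : Polynomial ℝ) (x : ℝ≥0),
      (Polynomial.aeval f p) x = p.sum fun n a => a * Real.exp (-n * x) := by
    intro p x
    rw [Polynomial.aeval_eq_sum_range, Polynomial.sum_over_range]
    · simp only [BoundedContinuousFunction.coe_sum, Finset.sum_apply,
        BoundedContinuousFunction.coe_smul, BoundedContinuousFunction.coe_pow, Pi.pow_apply, hf,
        smul_eq_mul]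
      refine Finset.sum_congr rfl fun n _ => ?_
      rw [← Real.exp_nat_mul]
      congr 2
      ring
    · simp
  have hint : ∀ (ρ : Measure ℝ≥0) [IsFiniteMeasure ρ] (n : ℕ),
      Integrable (fun x : ℝ≥0 => Real.exp (-n * x)) ρ := by
    intro ρ _ n
    refine Integrable.of_bound (by fun_prop) 1 (ae_of_all _ fun x => ?_)
    rw [Real.norm_eq_abs, abs_of_pos (Real.exp_pos _), Real.exp_le_one_iff]
    have : (0 : ℝ) ≤ n * x := by positivity
    linarith
  refine ext_of_forall_mem_subalgebra_integral_eq_of_polish (𝕜 := ℝ) (A := A) ?_ ?_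
  · intro x y hxy
    refine ⟨f, ⟨BoundedContinuousFunction.toContinuousMapStarₐ ℝ f, ?_, rfl⟩, ?_⟩
    · refine ⟨f, ?_, rfl⟩
      have := hmem Polynomial.X
      rwa [Polynomial.aeval_X] at this
    · rw [hf, hf]
      simpa using hxy
  · rintro g ⟨p, rfl⟩
    have key : ∀ (ρ : Measure ℝ≥0) [IsFiniteMeasure ρ],
        ∫ x, (Polynomial.aeval f p) x ∂ρ =
          ∑ n ∈ p.support, p.coeff n * ∫ x : ℝ≥0, Real.exp (-n * x) ∂ρ := by
      intro ρ _
      simp_rw [heval, Polynomial.sum_def]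
      rw [integral_finsetSum _ fun n _ => (hint ρ n).const_mul _]
      simp_rw [integral_const_mul]
    have := key μ
    have h2 := key ν
    simp_rw [h] at this
    exact this.trans h2.symm

/-- Finite measures carried by `[0, ∞)` are determined by their Laplace transform. -/
theorem measure_ext_of_integral_exp_neg {μ ν : Measure ℝ} [IsFiniteMeasure μ] [IsFiniteMeasure ν]
    (hμ : ∀ᵐ x ∂μ, 0 ≤ x) (hν : ∀ᵐ x ∂ν, 0 ≤ x)
    (h : ∀ s : ℝ, 0 ≤ s → ∫ x, Real.exp (-s * x) ∂μ = ∫ x, Real.exp (-s * x) ∂ν) :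
    μ = ν := by
  have hback : ∀ (ρ : Measure ℝ), (∀ᵐ x ∂ρ, 0 ≤ x) →
      (ρ.map Real.toNNReal).map ((↑) : ℝ≥0 → ℝ) = ρ := by
    intro ρ hρ
    rw [Measure.map_map (by fun_prop) (by fun_prop)]
    conv_rhs => rw [← Measure.map_id (μ := ρ)]
    refine Measure.map_congr ?_
    filter_upwards [hρ] with x hx
    simp [hx]
  have hmap : ∀ (ρ : Measure ℝ), (∀ᵐ x ∂ρ, 0 ≤ x) → ∀ n : ℕ,
      ∫ x : ℝ≥0, Real.exp (-n * x) ∂(ρ.map Real.toNNReal) = ∫ x, Real.exp (-n * x) ∂ρ := by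
    intro ρ hρ n
    rw [integral_map (by fun_prop) (by fun_prop)]
    refine integral_congr_ae ?_
    filter_upwards [hρ] with x hx
    simp [hx]
  rw [← hback μ hμ, ← hback ν hν]
  congr 1
  refine NNReal.measure_ext_of_integral_exp_neg fun n => ?_
  rw [hmap μ hμ, hmap ν hν, h n n.cast_nonneg]

/-- A probability measure on `[0, ∞)` with Laplace transform `exp (-C s ^ β)`, `0 < β < 1`, is
one-sided stable of index `β`. -/
theorem isOneSidedStable_of_integral_exp_neg {μ : Measure ℝ} [IsProbabilityMeasure μ]
    (hμ : ∀ᵐ x ∂μ, 0 ≤ x) {C β : ℝ} (hC : 0 < C) (hβ : 0 < β) (hβ' : β < 1)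
    (h : ∀ s : ℝ, 0 ≤ s → ∫ x, Real.exp (-s * x) ∂μ = Real.exp (-C * s ^ β)) :
    IsOneSidedStable μ β where
  isProbabilityMeasure := inferInstance
  nonneg := hμ
  nondegenerate := by
    -- A Dirac mass has a log-transform linear in `s`; comparing `s = 1` and `s = 2` would force `2
    -- ^ β = 2`.
    rintro x rfl
    have h1 := h 1 zero_le_one
    have h2 := h 2 zero_le_two
    rw [integral_dirac, Real.exp_eq_exp] at h1 h2
    have h3 : (2 : ℝ) ^ β < 2 := by
      simpa using Real.rpow_lt_rpow_of_exponent_lt (x := 2) one_lt_two hβ'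
    rw [Real.one_rpow] at h1
    nlinarith
  stable := by
    intro a b ha hb
    set r : ℝ := (a ^ β + b ^ β) ^ (1 / β)
    have hr : 0 < r := by positivity
    have hrβ : r ^ β = a ^ β + b ^ β := by
      rw [← Real.rpow_mul (by positivity), one_div_mul_cancel hβ.ne', Real.rpow_one]
    have : IsProbabilityMeasure ((μ.prod μ).map (fun p : ℝ × ℝ => a * p.1 + b * p.2)) :=
      Measure.isProbabilityMeasure_map (by fun_prop)
    have : IsProbabilityMeasure (μ.map (fun x => r * x)) :=
      Measure.isProbabilityMeasure_map (by fun_prop)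
    refine measure_ext_of_integral_exp_neg ?_ ?_ fun s hs => ?_
    · rw [ae_map_iff (by fun_prop) measurableSet_Ici]
      filter_upwards [Measure.quasiMeasurePreserving_fst.ae hμ,
        Measure.quasiMeasurePreserving_snd.ae hμ] with p h1 h2
      positivity
    · rw [ae_map_iff (by fun_prop) measurableSet_Ici]
      filter_upwards [hμ] with x hx
      positivity
    · rw [integral_map (by fun_prop) (by fun_prop), integral_map (by fun_prop) (by fun_prop)]
      have h1 : ∀ p : ℝ × ℝ, Real.exp (-s * (a * p.1 + b * p.2)) =
          Real.exp (-(s * a) * p.1) * Real.exp (-(s * b) * p.2) := by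
        intro p
        rw [← Real.exp_add]
        congr 1
        ring
      have h2 : ∀ x : ℝ, Real.exp (-s * (r * x)) = Real.exp (-(s * r) * x) := by
        intro x
        congr 1
        ring
      simp_rw [h1, h2]
      rw [integral_prod_mul (fun x => Real.exp (-(s * a) * x)) fun x => Real.exp (-(s * b) * x),
        h _ (by positivity), h _ (by positivity), h _ (by positivity), ← Real.exp_add,
        Real.mul_rpow hs ha.le, Real.mul_rpow hs hb.le, Real.mul_rpow hs hr.le, hrβ]
      congr 1
      ring

/-! ### Stopped exponentials of real sequences. -/

/-- The exponential `exp (-l x_k - s d k)` along a sequence `x` sampled at times `0, d, 2 d, …`,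
stopped at the first index where `x` is negative. -/
noncomputable def stoppedExp (l s d : ℝ) (x : ℕ → ℝ) : ℕ → ℝ
  | 0 => Real.exp (-l * x 0)
  | k + 1 => by
      classical
      exact stoppedExp l s d x k *
        if ∀ i ≤ k, 0 ≤ x i then Real.exp (-l * (x (k + 1) - x k) - s * d) else 1

lemma stoppedExp_pos (l s d : ℝ) (x : ℕ → ℝ) (k : ℕ) : 0 < stoppedExp l s d x k := by
  induction k with
  | zero => exact Real.exp_pos _
  | succ k ih =>
    rw [stoppedExp]
    split_ifs <;> positivity

/-- Thanks to this, second moments obey the same one-step recursion as first moments. -/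
lemma stoppedExp_sq (l s d : ℝ) (x : ℕ → ℝ) (k : ℕ) :
    stoppedExp l s d x k ^ 2 = stoppedExp (2 * l) (2 * s) d x k := by
  induction k with
  | zero =>
    rw [stoppedExp, stoppedExp, ← Real.exp_nat_mul]
    congr 1
    push_cast
    ring
  | succ k ih =>
    rw [stoppedExp, stoppedExp, mul_pow, ih]
    congr 1
    split_ifs
    · rw [← Real.exp_nat_mul]
      congr 1
      push_cast
      ring
    · simp

lemma stoppedExp_congr (l s d : ℝ) {x y : ℕ → ℝ} {k : ℕ} (h : ∀ i ≤ k, x i = y i) :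
    stoppedExp l s d x k = stoppedExp l s d y k := by
  induction k with
  | zero => simp [stoppedExp, h 0 le_rfl]
  | succ k ih =>
    have h' : (∀ i ≤ k, 0 ≤ x i) ↔ ∀ i ≤ k, 0 ≤ y i :=
      forall₂_congr fun i hi => by rw [h i (by omega)]
    rw [stoppedExp, stoppedExp, ih fun i hi => h i (by omega), h (k + 1) le_rfl, h k (by omega)]
    simp only [h']

lemma measurableSet_forall_le_nonneg (k : ℕ) :
    MeasurableSet {x : ℕ → ℝ | ∀ i ≤ k, 0 ≤ x i} := by
  simp only [Set.ofPred_forall]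
  exact MeasurableSet.iInter fun i => MeasurableSet.iInter fun _ =>
    measurableSet_le measurable_const (measurable_pi_apply i)

lemma measurable_stoppedExp (l s d : ℝ) (k : ℕ) :
    Measurable fun x : ℕ → ℝ => stoppedExp l s d x k := by
  induction k with
  | zero => simp only [stoppedExp]; fun_prop
  | succ k ih =>
    simp only [stoppedExp]
    refine ih.mul (Measurable.ite (measurableSet_forall_le_nonneg k) (by fun_prop) (by fun_prop))

/-- The value of `stoppedExp` is the exponential at the stopping index. -/
lemma exists_stoppedExp_eq (l s d : ℝ) (x : ℕ → ℝ) (k : ℕ) :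
    ∃ j ≤ k, stoppedExp l s d x k = Real.exp (-l * x j - s * (j * d)) ∧
      (∀ i < j, 0 ≤ x i) ∧ (j < k → x j < 0) := by
  induction k with
  | zero => exact ⟨0, le_rfl, by simp [stoppedExp], by simp, by simp⟩
  | succ k ih =>
    obtain ⟨j, hjk, hval, hpre, hneg⟩ := ih
    rw [stoppedExp]
    by_cases hA : ∀ i ≤ k, 0 ≤ x i
    · have hj : j = k := by
        by_contra hne
        exact absurd (hneg (by omega)) (not_lt.2 (hA j hjk))
      subst hj
      refine ⟨j + 1, le_rfl, ?_, fun i hi => hA i (by omega), fun h => absurd h (lt_irrefl _)⟩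
      rw [if_pos hA, hval, ← Real.exp_add]
      congr 1
      push_cast
      ring
    · refine ⟨j, by omega, by rw [if_neg hA, mul_one, hval], hpre, fun _ => ?_⟩
      rcases hjk.lt_or_eq with h | rfl
      · exact hneg h
      · by_contra hnn
        refine hA fun i hi => ?_
        rcases hi.lt_or_eq with h | rfl
        · exact hpre i h
        · exact not_lt.1 hnn

/-! ### Moments for Gaussian walks and passage to the limit. -/

section Expectation

variable {Ω : Type*} [MeasurableSpace Ω] {P : Measure Ω}

/-- One step of the stopped exponential of a Gaussian random walk. -/
lemma integral_stoppedExp_succ {S : ℕ → Ω → ℝ} (hS : ∀ k, Measurable (S k)) {d : ℝ≥0} {k : ℕ}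
    (hlaw : P.map (fun ω => S (k + 1) ω - S k ω) = gaussianReal 0 d)
    (hindep : IndepFun (fun ω (i : Set.Iic k) => S i ω) (fun ω => S (k + 1) ω - S k ω) P)
    (l s : ℝ) (hint : Integrable (fun ω => stoppedExp l s d (fun i => S i ω) k) P) :
    Integrable (fun ω => stoppedExp l s d (fun i => S i ω) (k + 1)) P ∧
    ∃ u v : ℝ, 0 ≤ u ∧ 0 ≤ v ∧ u + v = ∫ ω, stoppedExp l s d (fun i => S i ω) k ∂P ∧
      ∫ ω, stoppedExp l s d (fun i => S i ω) (k + 1) ∂P =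
        u * Real.exp (d * l ^ 2 / 2 - s * d) + v := by
  classical
  set X : Ω → ℕ → ℝ := fun ω i => S i ω
  have hX : Measurable X := measurable_pi_iff.2 hS
  set A : Set (ℕ → ℝ) := {x | ∀ i ≤ k, 0 ≤ x i}
  have hA : MeasurableSet A := measurableSet_forall_le_nonneg k
  set z : (ℕ → ℝ) → ℝ := fun x => stoppedExp l s d x k
  have hz : Measurable z := measurable_stoppedExp l s d k
  -- `U` is the part still running at step `k`, `V` the part already stopped; only `U` picks up the
  -- independent factor `G`.
  set U : Ω → ℝ := fun ω => A.indicator z (X ω)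
  set V : Ω → ℝ := fun ω => Aᶜ.indicator z (X ω)
  set D : Ω → ℝ := fun ω => S (k + 1) ω - S k ω
  have hD : Measurable D := (hS _).sub (hS _)
  set G : Ω → ℝ := fun ω => Real.exp (-l * D ω - s * d)
  have hUint : Integrable U P := by
    have := hint.indicator (hX hA)
    exact this
  have hVint : Integrable V P := by
    have := hint.indicator (hX hA.compl)
    exact this
  have hGeq : G = fun ω => Real.exp (-l * D ω) * Real.exp (-(s * d)) := by
    funext ω
    rw [← Real.exp_add]
    rfl
  have hGint : Integrable G P := by
    rw [hGeq]
    refine Integrable.mul_const ?_ _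
    have := integrable_exp_mul_gaussianReal (μ := 0) (v := d) (-l)
    rw [← hlaw] at this
    exact this.comp_measurable hD
  have hGval : ∫ ω, G ω ∂P = Real.exp (d * l ^ 2 / 2 - s * d) := by
    rw [hGeq, integral_mul_const]
    have := mgf_gaussianReal hlaw (-l)
    rw [mgf] at this
    rw [this, ← Real.exp_add]
    congr 1
    ring
  -- Extending the history by zero exhibits `U` as a function of the coordinates up to `k`, as
  -- `hindep` requires.
  let e : (Set.Iic k → ℝ) → ℕ → ℝ := fun v i => if h : i ≤ k then v ⟨i, h⟩ else 0
  have he : Measurable e := by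
    refine measurable_pi_iff.2 fun i => ?_
    by_cases h : i ≤ k
    · simp only [e, h, dite_true]; fun_prop
    · simp only [e, h, dite_false]; fun_prop
  have hUG : IndepFun U G P := by
    have h1 := hindep.comp (φ := fun v => A.indicator z (e v))
      (ψ := fun y : ℝ => Real.exp (-l * y - s * d)) ((hz.indicator hA).comp he) (by fun_prop)
    convert h1 using 1
    · funext ω
      have hev : ∀ i ≤ k, X ω i = e (fun i : Set.Iic k => S i ω) i := by
        intro i hi
        simp [e, hi, X]
      have hmem : X ω ∈ A ↔ e (fun i : Set.Iic k => S i ω) ∈ A :=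
        forall₂_congr fun i hi => by rw [hev i hi]
      simp only [U, Function.comp_apply, Set.indicator_apply, hmem]
      rw [show z (X ω) = z (e fun i : Set.Iic k => S i ω) from stoppedExp_congr l s d hev]
    · rfl
  have hsucc : (fun ω => stoppedExp l s d (X ω) (k + 1)) = fun ω => (U * G) ω + V ω := by
    funext ω
    rw [stoppedExp]
    by_cases h : X ω ∈ A
    · rw [if_pos (show ∀ i ≤ k, 0 ≤ X ω i from h)]
      simp [U, V, h, z, G, D, X]
    · rw [if_neg (show ¬ ∀ i ≤ k, 0 ≤ X ω i from h)]
      simp [U, V, h, z]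
  have hUGint : Integrable (U * G) P := hUG.integrable_mul hUint hGint
  refine ⟨by rw [hsucc]; exact hUGint.add hVint, ∫ ω, U ω ∂P, ∫ ω, V ω ∂P, ?_, ?_, ?_, ?_⟩
  · exact integral_nonneg fun ω => Set.indicator_nonneg (fun x _ => (stoppedExp_pos ..).le) _
  · exact integral_nonneg fun ω => Set.indicator_nonneg (fun x _ => (stoppedExp_pos ..).le) _
  · rw [← integral_add hUint hVint]
    refine integral_congr_ae (ae_of_all _ fun ω => ?_)
    exact congrFun (Set.indicator_self_add_compl A z) (X ω)
  · rw [hsucc, integral_add hUGint hVint,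
      hUG.integral_mul_eq_mul_integral hUint.aestronglyMeasurable hGint.aestronglyMeasurable, hGval]

variable [IsProbabilityMeasure P]

/-- Expectation and second moment of the stopped exponential martingale of a Gaussian random walk
started at a nonnegative random point. -/
lemma integral_stoppedExp {S : ℕ → Ω → ℝ} (hS : ∀ k, Measurable (S k)) {d : ℝ≥0}
    (hS0 : ∀ᵐ ω ∂P, 0 ≤ S 0 ω)
    (hlaw : ∀ k, P.map (fun ω => S (k + 1) ω - S k ω) = gaussianReal 0 d)
    (hindep : ∀ k, IndepFun (fun ω (i : Set.Iic k) => S i ω) (fun ω => S (k + 1) ω - S k ω) P)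
    {l s : ℝ} (hl : 0 ≤ l) (hls : l ^ 2 = 2 * s) (k : ℕ) :
    Integrable (fun ω => stoppedExp l s d (fun i => S i ω) k) P ∧
    ∫ ω, stoppedExp l s d (fun i => S i ω) k ∂P = ∫ ω, Real.exp (-l * S 0 ω) ∂P ∧
    Integrable (fun ω => stoppedExp l s d (fun i => S i ω) k ^ 2) P ∧
    ∫ ω, stoppedExp l s d (fun i => S i ω) k ^ 2 ∂P ≤ Real.exp (2 * s * (k * d)) := by
  have hbound : ∀ r : ℝ, 0 ≤ r → ∀ᵐ ω ∂P, ‖Real.exp (-r * S 0 ω)‖ ≤ 1 := by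
    intro r hr
    filter_upwards [hS0] with ω hω
    rw [Real.norm_eq_abs, abs_of_pos (Real.exp_pos _), Real.exp_le_one_iff]
    nlinarith
  have hint0 : ∀ r : ℝ, 0 ≤ r → Integrable (fun ω => Real.exp (-r * S 0 ω)) P := fun r hr =>
    Integrable.of_bound (((hS 0).const_mul (-r)).exp.aestronglyMeasurable) 1 (hbound r hr)
  simp_rw [stoppedExp_sq]
  induction k with
  | zero =>
    simp only [stoppedExp]
    refine ⟨hint0 l hl, trivial, hint0 (2 * l) (by positivity), ?_⟩
    refine (integral_mono_ae (hint0 (2 * l) (by positivity)) (integrable_const 1) ?_).trans ?_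
    · filter_upwards [hbound (2 * l) (by positivity)] with ω hω using (le_abs_self _).trans hω
    · simp
  | succ k ih =>
    obtain ⟨h1, h2, h3, h4⟩ := ih
    obtain ⟨i1, u, v, -, -, huv, hval⟩ := integral_stoppedExp_succ hS (hlaw k) (hindep k) l s h1
    obtain ⟨i2, u', v', hu', hv', huv', hval'⟩ :=
      integral_stoppedExp_succ hS (hlaw k) (hindep k) (2 * l) (2 * s) h3
    have hs : 0 ≤ s := by nlinarith [sq_nonneg l]
    -- The relation `l ^ 2 = 2 s` cancels the drift exactly; for the doubled parameters of the
    -- square a growth rate `2 s` is left over.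
    have e1 : (d : ℝ) * l ^ 2 / 2 - s * d = 0 := by rw [hls]; ring
    have e2 : (d : ℝ) * (2 * l) ^ 2 / 2 - 2 * s * d = 2 * s * d := by rw [mul_pow, hls]; ring
    have h0 : 0 ≤ 2 * s * (d : ℝ) := by positivity
    refine ⟨i1, by rw [hval, e1, Real.exp_zero, mul_one, huv, h2], i2, ?_⟩
    rw [hval', e2]
    have hone : 1 ≤ Real.exp (2 * s * d) := Real.one_le_exp h0
    calc u' * Real.exp (2 * s * d) + v' ≤ (u' + v') * Real.exp (2 * s * d) := by nlinarith
      _ ≤ Real.exp (2 * s * (k * d)) * Real.exp (2 * s * d) := by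
        rw [huv']; gcongr
      _ = _ := by
        rw [← Real.exp_add]
        congr 1
        push_cast
        ring

/-- Convergence of expectations under an `L²` bound, for nonnegative functions and a limit bounded
by one. -/
lemma integral_eq_of_tendsto_of_sq_le {Z : ℕ → Ω → ℝ} {L : Ω → ℝ} {m C : ℝ}
    (hpos : ∀ n ω, 0 ≤ Z n ω) (hint : ∀ n, Integrable (Z n) P)
    (hint2 : ∀ n, Integrable (fun ω => Z n ω ^ 2) P)
    (hm : ∀ n, ∫ ω, Z n ω ∂P = m) (hC : ∀ n, ∫ ω, Z n ω ^ 2 ∂P ≤ C)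
    (hL : ∀ᵐ ω ∂P, L ω ≤ 1)
    (hlim : ∀ᵐ ω ∂P, Filter.Tendsto (fun n => Z n ω) Filter.atTop (nhds (L ω))) :
    ∫ ω, L ω ∂P = m := by
  have hC0 : 0 ≤ C := (integral_nonneg fun ω => sq_nonneg _).trans (hC 0)
  -- Truncation at `K ≥ 1` leaves the limit `L ≤ 1` unchanged and costs at most `Z ^ 2 / K` before
  -- the limit.
  have key : ∀ K : ℝ, 1 ≤ K → |∫ ω, L ω ∂P - m| ≤ C / K := by
    intro K hK
    have hK0 : 0 < K := by linarith
    have hbd : ∀ n ω, ‖min (Z n ω) K‖ ≤ K := by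
      intro n ω
      rw [Real.norm_eq_abs, abs_of_nonneg (le_min (hpos n ω) hK0.le)]
      exact min_le_right _ _
    have hmeas : ∀ n, AEStronglyMeasurable (fun ω => min (Z n ω) K) P := fun n =>
      ((hint n).aestronglyMeasurable.aemeasurable.min aemeasurable_const).aestronglyMeasurable
    have hintm : ∀ n, Integrable (fun ω => min (Z n ω) K) P := fun n =>
      Integrable.of_bound (hmeas n) K (ae_of_all _ (hbd n))
    have ht : Filter.Tendsto (fun n => ∫ ω, min (Z n ω) K ∂P) Filter.atTop
        (nhds (∫ ω, L ω ∂P)) := by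
      refine tendsto_integral_of_dominated_convergence (fun _ => K) hmeas (integrable_const K)
        (fun n => ae_of_all _ (hbd n)) ?_
      filter_upwards [hL, hlim] with ω h1 h2
      have := h2.min (tendsto_const_nhds (x := K))
      rwa [min_eq_left (h1.trans hK)] at this
    refine le_of_tendsto ((ht.sub_const m).abs) (Filter.Eventually.of_forall fun n => ?_)
    rw [← hm n, ← integral_sub (hintm n) (hint n)]
    refine (abs_integral_le_integral_abs).trans ?_
    calc ∫ ω, |min (Z n ω) K - Z n ω| ∂P ≤ ∫ ω, Z n ω ^ 2 / K ∂P := by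
          refine integral_mono ((hintm n).sub (hint n)).abs ((hint2 n).div_const K) fun ω => ?_
          have hz := hpos n ω
          change |min (Z n ω) K - Z n ω| ≤ Z n ω ^ 2 / K
          rw [le_div_iff₀ hK0]
          rcases le_total (Z n ω) K with h | h
          · rw [min_eq_left h]; simp; positivity
          · rw [min_eq_right h, abs_of_nonpos (by linarith)]
            nlinarith
      _ = (∫ ω, Z n ω ^ 2 ∂P) / K := integral_div _ _
      _ ≤ C / K := by gcongr; exact hC n
  have hlimK : Filter.Tendsto (fun K : ℝ => C / K) Filter.atTop (nhds 0) :=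
    Filter.Tendsto.const_div_atTop Filter.tendsto_id C
  have h0 : |∫ ω, L ω ∂P - m| ≤ 0 :=
    ge_of_tendsto hlimK ((Filter.eventually_ge_atTop 1).mono key)
  exact sub_eq_zero.1 (abs_nonpos_iff.1 h0)

end Expectation

/-! ### Convergence along a continuous path. -/

/-- The first strictly positive time at which a path is negative. -/
noncomputable def firstNegTime (y : ℝ≥0 → ℝ) : ℝ≥0∞ :=
  ⨅ (t : ℝ≥0) (_ : 0 < t ∧ y t < 0), (t : ℝ≥0∞)

section Path

variable {y : ℝ≥0 → ℝ}

lemma firstNegTime_le {t : ℝ≥0} (ht : 0 < t) (hy : y t < 0) : firstNegTime y ≤ t :=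
  iInf₂_le t ⟨ht, hy⟩

lemma exists_lt_of_firstNegTime_lt {b : ℝ≥0∞} (h : firstNegTime y < b) :
    ∃ t : ℝ≥0, 0 < t ∧ y t < 0 ∧ (t : ℝ≥0∞) < b := by
  simp only [firstNegTime, iInf_lt_iff] at h
  obtain ⟨t, ⟨h1, h2⟩, h3⟩ := h
  exact ⟨t, h1, h2, h3⟩

/-- A negative value at `a > 0` would by continuity occur already slightly before `a`. Time zero is
not seen by the infimum, hence `hy0`. -/
lemma nonneg_of_le_firstNegTime (hy : Continuous y) (hy0 : 0 ≤ y 0) {a : ℝ≥0}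
    (ha : (a : ℝ≥0∞) ≤ firstNegTime y) : 0 ≤ y a := by
  rcases eq_or_ne a 0 with rfl | hne
  · exact hy0
  have hpos : 0 < a := pos_iff_ne_zero.2 hne
  by_contra! hneg
  have h1 : ∀ᶠ t in nhdsWithin a (Set.Iio a), y t < 0 :=
    nhdsWithin_le_nhds (hy.continuousAt.eventually_lt continuousAt_const hneg)
  have h2 : ∀ᶠ t in nhdsWithin a (Set.Iio a), t ∈ Set.Ioo 0 a := Ioo_mem_nhdsLT hpos
  have : (nhdsWithin a (Set.Iio a)).NeBot := nhdsLT_neBot_of_exists_lt ⟨0, hpos⟩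
  obtain ⟨t, ht1, ht2⟩ := (h1.and h2).exists
  exact absurd (ha.trans (firstNegTime_le ht2.1 ht1)) (by simpa using ht2.2)

/-- The limit of the stopped exponentials along finer and finer grids of `[0, T]`. -/
noncomputable def stoppedExpLimit (l s : ℝ) (y : ℝ≥0 → ℝ) (T : ℝ≥0) : ℝ :=
  if firstNegTime y < T then Real.exp (-s * (firstNegTime y).toReal)
  else Real.exp (-l * y T - s * T)

lemma stoppedExpLimit_le_one (hy : Continuous y) (hy0 : 0 ≤ y 0) {l s : ℝ} (hl : 0 ≤ l)
    (hs : 0 ≤ s) (T : ℝ≥0) : stoppedExpLimit l s y T ≤ 1 := by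
  rw [stoppedExpLimit]
  split_ifs with h
  · rw [Real.exp_le_one_iff, neg_mul]
    have : 0 ≤ s * (firstNegTime y).toReal := by positivity
    linarith
  · rw [Real.exp_le_one_iff]
    have h1 := mul_nonneg hl (nonneg_of_le_firstNegTime hy hy0 (not_lt.1 h))
    have h2 : 0 ≤ s * T := by positivity
    linarith

lemma tendsto_floor_mul_grid {t T : ℝ≥0} (hT : 0 < T) :
    Filter.Tendsto (fun n : ℕ => (⌊(t / T : ℝ) * ((n : ℝ) + 1)⌋₊ : ℝ≥0) * (T / (n + 1)))
      Filter.atTop (nhds t) := by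
  have hT' : (0 : ℝ) < T := hT
  have h1 : Filter.Tendsto (fun n : ℕ => (n : ℝ) + 1) Filter.atTop Filter.atTop :=
    Filter.tendsto_atTop_add_const_right _ _ tendsto_natCast_atTop_atTop
  have h2 := ((tendsto_nat_floor_mul_div_atTop (R := ℝ) (a := t / T) (by positivity)).comp
    h1).mul_const (T : ℝ)
  rw [div_mul_cancel₀ _ hT'.ne'] at h2
  rw [← NNReal.tendsto_coe]
  refine h2.congr fun n => ?_
  push_cast
  simp only [Function.comp_apply]
  ring

/-- If the path turns negative before `T`, the grid stopping times are at least the true one and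
converge to it; otherwise they all equal `T`. -/
lemma tendsto_stoppedExp_grid (hy : Continuous y) (hy0 : 0 ≤ y 0) (l s : ℝ) {T : ℝ≥0}
    (hT : 0 < T) :
    Filter.Tendsto (fun n : ℕ => stoppedExp l s (T / (n + 1) : ℝ≥0)
        (fun i => y (i * (T / (n + 1)))) (n + 1)) Filter.atTop
      (nhds (stoppedExpLimit l s y T)) := by
  choose j hj hval hpre hneg using fun n : ℕ =>
    exists_stoppedExp_eq l s (T / (n + 1) : ℝ≥0) (fun i => y (i * (T / (n + 1)))) (n + 1)
  set r : ℕ → ℝ≥0 := fun n => j n * (T / (n + 1)) with hr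
  have hd : ∀ n : ℕ, 0 < T / ((n : ℝ≥0) + 1) := fun n => by positivity
  have hend : ∀ n : ℕ, ((n + 1 : ℕ) : ℝ≥0) * (T / (n + 1)) = T := by
    intro n
    push_cast
    field_simp
  have hvalr : ∀ n : ℕ, stoppedExp l s (T / (n + 1) : ℝ≥0)
      (fun i => y (i * (T / (n + 1)))) (n + 1) = Real.exp (-l * y (r n) - s * r n) := by
    intro n
    rw [hval]
    simp [hr]
  simp only [hvalr]
  have hearly : ∀ n, j n < n + 1 → r n < T ∧ y (r n) < 0 ∧ firstNegTime y ≤ r n := by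
    intro n h
    have h1 : y (r n) < 0 := hneg n h
    have h0 : 0 < r n := by
      rw [pos_iff_ne_zero]
      intro h0
      rw [h0] at h1
      exact absurd h1 (not_lt.2 hy0)
    refine ⟨?_, h1, firstNegTime_le h0 h1⟩
    rw [← hend n]
    exact mul_lt_mul_of_pos_right (by exact_mod_cast h) (hd n)
  have hfull : ∀ n, ¬ j n < n + 1 → r n = T := by
    intro n h
    have : j n = n + 1 := le_antisymm (hj n) (not_lt.1 h)
    rw [hr]
    simp only [this]
    exact hend n
  rw [stoppedExpLimit]
  split_ifs with hτ
  · set a : ℝ≥0 := (firstNegTime y).toNNReal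
    have hcoe : (a : ℝ≥0∞) = firstNegTime y := ENNReal.coe_toNNReal (hτ.trans_le le_top).ne
    have haT : a < T := by rw [← hcoe] at hτ; exact_mod_cast hτ
    have hge : ∀ n, a ≤ r n := by
      intro n
      by_cases h : j n < n + 1
      · have := (hearly n h).2.2
        rw [← hcoe] at this
        exact_mod_cast this
      · rw [hfull n h]; exact haT.le
    -- Negativity at some `t < b` persists at the grid points just below `t`, so the grid walk has
    -- stopped by then.
    have hlt : ∀ b > a, ∀ᶠ n in Filter.atTop, r n < b := by
      intro b hb
      obtain ⟨t, ht0, hyt, htb⟩ := exists_lt_of_firstNegTime_lt (y := y) (b := b)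
        (by rw [← hcoe]; exact_mod_cast hb)
      have ht := tendsto_floor_mul_grid (t := t) hT
      have e1 := ht.eventually (hy.continuousAt.eventually_lt continuousAt_const hyt)
      have e2 := ht.eventually_lt_const (show t < b by exact_mod_cast htb)
      filter_upwards [e1, e2] with n h1 h2
      refine lt_of_le_of_lt ?_ h2
      refine mul_le_mul_left ?_ _
      by_contra! hcon
      exact absurd h1 (not_lt.2 (hpre n _ (by exact_mod_cast hcon)))
    have hlim : Filter.Tendsto r Filter.atTop (nhds a) :=
      tendsto_order.2 ⟨fun b hb => Filter.Eventually.of_forall fun n => hb.trans_le (hge n), hlt⟩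
    -- The value at `a` is a limit of negative values, so the overshoot disappears.
    have hya : y a = 0 := by
      refine le_antisymm ?_ (nonneg_of_le_firstNegTime hy hy0 hcoe.le)
      refine le_of_tendsto ((hy.tendsto a).comp hlim) ?_
      filter_upwards [hlt T haT] with n hn
      by_contra! hcon
      by_cases h : j n < n + 1
      · exact absurd (hearly n h).2.1 (not_lt.2 hcon.le)
      · exact absurd (hfull n h) hn.ne
    have hcont : Continuous fun t : ℝ≥0 => Real.exp (-l * y t - s * t) := by fun_prop
    have hval_a : Real.exp (-l * y a - s * a) = Real.exp (-s * (firstNegTime y).toReal) := by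
      rw [hya, mul_zero, zero_sub, neg_mul]
      rfl
    rw [← hval_a]
    exact (hcont.tendsto a).comp hlim
  · have : ∀ n, r n = T := by
      intro n
      by_cases h : j n < n + 1
      · obtain ⟨h1, -, h2⟩ := hearly n h
        exact absurd (h2.trans_lt (by exact_mod_cast h1)) hτ
      · exact hfull n h
    simp [this]

/-- For a finite hitting time the sequence is eventually constant; for an infinite one it is at most
`exp (-s (n + 1))`, which needs `s > 0`. -/
lemma tendsto_stoppedExpLimit (hy : Continuous y) (hy0 : 0 ≤ y 0) {l s : ℝ} (hl : 0 ≤ l)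
    (hs : 0 < s) :
    Filter.Tendsto (fun n : ℕ => stoppedExpLimit l s y (n + 1)) Filter.atTop
      (nhds (expNegMul s (firstNegTime y))) := by
  have hcast : Filter.Tendsto (fun n : ℕ => (n : ℝ) + 1) Filter.atTop Filter.atTop :=
    Filter.tendsto_atTop_add_const_right _ _ tendsto_natCast_atTop_atTop
  rw [expNegMul]
  split_ifs with hτ
  · have h0 : Filter.Tendsto (fun n : ℕ => Real.exp (-(s * ((n : ℝ) + 1)))) Filter.atTop
        (nhds 0) :=
      Real.tendsto_exp_neg_atTop_nhds_zero.comp (hcast.const_mul_atTop hs)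
    refine squeeze_zero (fun n => ?_) (fun n => ?_) h0
    · rw [stoppedExpLimit]; split_ifs <;> positivity
    · rw [stoppedExpLimit, if_neg (by simp [hτ]), Real.exp_le_exp]
      have h1 := mul_nonneg hl (nonneg_of_le_firstNegTime hy hy0 (a := n + 1) (by simp [hτ]))
      push_cast
      linarith
  · refine tendsto_const_nhds.congr' ?_
    filter_upwards [hcast.eventually_gt_atTop (firstNegTime y).toReal] with n hn
    rw [stoppedExpLimit, if_pos]
    rw [← ENNReal.coe_toNNReal hτ, ENNReal.coe_lt_coe, ← NNReal.coe_lt_coe]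
    push_cast
    exact hn

end Path

/-! ### Optional stopping for Brownian motion. -/

section Brownian

variable {Ω : Type*} [MeasurableSpace Ω] {P : Measure Ω} [IsProbabilityMeasure P]

lemma ProbabilityTheory.IndepFun.prodMk_left_of_prodMk_right {β γ δ : Type*} [MeasurableSpace β]
    [MeasurableSpace γ] [MeasurableSpace δ] {X : Ω → β} {Y : Ω → γ} {Z : Ω → δ}
    (hX : Measurable X) (hY : Measurable Y) (hZ : Measurable Z)
    (h : IndepFun X (fun ω => (Y ω, Z ω)) P) (hYZ : IndepFun Y Z P) :
    IndepFun (fun ω => (X ω, Y ω)) Z P := by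
  have hXY : IndepFun X Y P := h.comp measurable_id measurable_fst
  have := Measure.isProbabilityMeasure_map (μ := P) hX.aemeasurable
  have := Measure.isProbabilityMeasure_map (μ := P) hY.aemeasurable
  have := Measure.isProbabilityMeasure_map (μ := P) hZ.aemeasurable
  rw [indepFun_iff_map_prod_eq_prod_map_map (by fun_prop) (by fun_prop)] at h hYZ hXY ⊢
  apply (MeasurableEquiv.prodAssoc (α := β) (β := γ) (γ := δ)).map_measurableEquiv_injective
  rw [Measure.map_map (by fun_prop) (by fun_prop), hXY, Measure.prodAssoc_prod, ← hYZ, ← h]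
  rfl

/-- Moments of the stopped exponential of a Brownian motion sampled on a grid, started at an
independent nonnegative random point. -/
lemma ProbabilityTheory.IsPreBrownianReal.integral_stoppedExp {W : ℝ≥0 → Ω → ℝ}
    (hW : IsPreBrownianReal W P) (hWm : ∀ t, Measurable (W t)) {ξ : Ω → ℝ} (hξ : Measurable ξ)
    (hξ_nonneg : ∀ᵐ ω ∂P, 0 ≤ ξ ω) (d : ℝ≥0)
    (hindep : IndepFun ξ (fun ω (i : ℕ) => W (i * d) ω) P) {l s : ℝ} (hl : 0 ≤ l)
    (hls : l ^ 2 = 2 * s) (k : ℕ) :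
    Integrable (fun ω => stoppedExp l s d (fun i => ξ ω + W (i * d) ω) k) P ∧
    ∫ ω, stoppedExp l s d (fun i => ξ ω + W (i * d) ω) k ∂P = ∫ ω, Real.exp (-l * ξ ω) ∂P ∧
    Integrable (fun ω => stoppedExp l s d (fun i => ξ ω + W (i * d) ω) k ^ 2) P ∧
    ∫ ω, stoppedExp l s d (fun i => ξ ω + W (i * d) ω) k ^ 2 ∂P ≤ Real.exp (2 * s * (k * d)) := by
  have hstart : ∀ᵐ ω ∂P, ξ ω + W ((0 : ℕ) * d) ω = ξ ω := by
    filter_upwards [hW.eval_zero_ae_eq_zero] with ω h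
    rw [Nat.cast_zero, zero_mul, h, add_zero]
  have hincr : ∀ (k : ℕ), (fun ω => ξ ω + W ((k + 1 : ℕ) * d) ω - (ξ ω + W (k * d) ω)) =
      W ((k + 1 : ℕ) * d) - W (k * d) := by
    intro k
    funext ω
    rw [Pi.sub_apply]
    ring
  have hS0 : ∀ᵐ ω ∂P, 0 ≤ ξ ω + W ((0 : ℕ) * d) ω := by
    filter_upwards [hstart, hξ_nonneg] with ω h1 h2
    rwa [h1]
  have hlaw : ∀ k : ℕ, P.map (fun ω => ξ ω + W ((k + 1 : ℕ) * d) ω - (ξ ω + W (k * d) ω)) =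
      gaussianReal 0 d := by
    intro k
    rw [hincr, (hW.hasLaw_sub ((k + 1 : ℕ) * d) (k * d)).map_eq]
    congr 1
    rw [← NNReal.coe_inj, coe_nndist, Real.dist_eq]
    change |(((k + 1 : ℕ) * d : ℝ≥0) : ℝ) - ((k * d : ℝ≥0) : ℝ)| = d
    push_cast
    rw [show ((k : ℝ) + 1) * d - k * d = d by ring, abs_of_nonneg d.coe_nonneg]
  have hind : ∀ k : ℕ, IndepFun (fun ω (i : Set.Iic k) => ξ ω + W ((i : ℕ) * d) ω)
      (fun ω => ξ ω + W ((k + 1 : ℕ) * d) ω - (ξ ω + W (k * d) ω)) P := by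
    intro k
    rw [hincr]
    set V : Ω → Set.Iic k → ℝ := fun ω i => W ((i : ℕ) * d) ω
    have hV : Measurable V := measurable_pi_iff.2 fun i => hWm _
    have hD : Measurable (W ((k + 1 : ℕ) * d) - W (k * d)) := (hWm _).sub (hWm _)
    -- The increment after time `k d` is independent of the path up to `k d`, which contains the
    -- sampled history.
    have hVD : IndepFun V (W ((k + 1 : ℕ) * d) - W (k * d)) P := by
      have hφ : Measurable fun w : ℝ≥0 → ℝ => w d := measurable_pi_apply _
      have hψ : Measurable fun (w : Set.Iic ((k : ℝ≥0) * d) → ℝ) (i : Set.Iic k) =>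
          w ⟨(i : ℕ) * d, mul_le_mul_left (by exact_mod_cast i.2) d⟩ :=
        measurable_pi_iff.2 fun i => measurable_pi_apply _
      refine ((hW.indepFun_shift (k * d)).comp hφ hψ).symm.congr (by rfl)
        (ae_of_all _ fun ω => ?_)
      simp only [Function.comp_apply, Pi.sub_apply]
      rw [Nat.cast_succ, add_one_mul]
    have hψ : Measurable fun w : ℕ → ℝ => ((fun i : Set.Iic k => w i), w (k + 1) - w k) := by
      fun_prop
    have hξVD : IndepFun ξ (fun ω => (V ω, (W ((k + 1 : ℕ) * d) - W (k * d)) ω)) P :=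
      hindep.comp measurable_id hψ
    have hadd : Measurable fun (p : ℝ × (Set.Iic k → ℝ)) (i : Set.Iic k) => p.1 + p.2 i := by
      fun_prop
    exact (hξVD.prodMk_left_of_prodMk_right hξ hV hD hVD).comp hadd measurable_id
  have h := _root_.integral_stoppedExp (P := P) (S := fun i ω => ξ ω + W (i * d) ω)
    (fun i => hξ.add (hWm _)) hS0 hlaw hind hl hls k
  refine ⟨h.1, h.2.1.trans (integral_congr_ae ?_), h.2.2⟩
  filter_upwards [hstart] with ω h
  rw [h]

/-- The Laplace transform of the hitting time of zero by a Brownian motion started at an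
independent nonnegative random point. -/
theorem integral_expNegMul_firstHittingTime {W : ℝ≥0 → Ω → ℝ} (hW : IsBrownianReal W P)
    {ξ : Ω → ℝ} (hξ : Measurable ξ) (hξ_nonneg : ∀ᵐ ω ∂P, 0 ≤ ξ ω)
    (hindep : IndepFun ξ (fun ω t => W t ω) P) {l s : ℝ} (hl : 0 ≤ l) (hs : 0 < s)
    (hls : l ^ 2 = 2 * s) :
    ∫ ω, expNegMul s (firstHittingTime 0 ξ W ω) ∂P = ∫ ω, Real.exp (-l * ξ ω) ∂P := by
  -- Measurable versions serve for the moments. They agree with `W` almost surely at all countably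
  -- many grid times used; path continuity is taken from `W` itself.
  set W' : ℝ≥0 → Ω → ℝ := fun t => (hW.aemeasurable t).mk (W t)
  have hWW' : ∀ t, W t =ᵐ[P] W' t := fun t => (hW.aemeasurable t).ae_eq_mk
  have hW'm : ∀ t, Measurable (W' t) := fun t => (hW.aemeasurable t).measurable_mk
  have hW' : IsPreBrownianReal W' P := hW.toIsPreBrownianReal.congr hWW'
  have hpath : ∀ᵐ ω ∂P, Continuous (fun t => ξ ω + W t ω) ∧ 0 ≤ ξ ω + W 0 ω := by
    filter_upwards [hW.cont, hξ_nonneg, hW.eval_zero_ae_eq_zero] with ω h1 h2 h3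
    exact ⟨by fun_prop, by rw [h3, add_zero]; exact h2⟩
  have hindep' : ∀ d : ℝ≥0, IndepFun ξ (fun ω (i : ℕ) => W' (i * d) ω) P := by
    intro d
    have hψ : Measurable fun (w : ℝ≥0 → ℝ) (i : ℕ) => w (i * d) := by fun_prop
    refine (hindep.comp measurable_id hψ).congr (by rfl) ?_
    have hall : ∀ᵐ ω ∂P, ∀ i : ℕ, W (i * d) ω = W' (i * d) ω := ae_all_iff.2 fun i => hWW' _
    filter_upwards [hall] with ω hω
    funext i
    exact hω i
  have hdisc := fun d : ℝ≥0 => hW'.integral_stoppedExp hW'm hξ hξ_nonneg d (hindep' d) hl hls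
  have hgrid : ∀ᵐ ω ∂P, ∀ n i m : ℕ, W (i * ((m + 1 : ℝ≥0) / (n + 1))) ω =
      W' (i * ((m + 1 : ℝ≥0) / (n + 1))) ω :=
    ae_all_iff.2 fun n => ae_all_iff.2 fun i => ae_all_iff.2 fun m => hWW' _
  have hlim : ∀ m : ℕ, ∀ᵐ ω ∂P, Filter.Tendsto (fun n : ℕ =>
      stoppedExp l s ((m + 1 : ℝ≥0) / (n + 1) : ℝ≥0)
        (fun i => ξ ω + W' (i * ((m + 1 : ℝ≥0) / (n + 1))) ω) (n + 1)) Filter.atTop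
      (nhds (stoppedExpLimit l s (fun t => ξ ω + W t ω) (m + 1))) := by
    intro m
    filter_upwards [hpath, hgrid] with ω h1 h2
    simp only [← h2]
    exact tendsto_stoppedExp_grid (y := fun t => ξ ω + W t ω) h1.1 h1.2 l s (by positivity)
  have hle : ∀ m : ℕ, ∀ᵐ ω ∂P, stoppedExpLimit l s (fun t => ξ ω + W t ω) (m + 1) ≤ 1 := by
    intro m
    filter_upwards [hpath] with ω h1
    exact stoppedExpLimit_le_one h1.1 h1.2 hl hs.le _
  have hval : ∀ m : ℕ, ∫ ω, stoppedExpLimit l s (fun t => ξ ω + W t ω) (m + 1) ∂P =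
      ∫ ω, Real.exp (-l * ξ ω) ∂P := by
    intro m
    have hdm := fun n : ℕ => hdisc ((m + 1 : ℝ≥0) / (n + 1)) (n + 1)
    refine integral_eq_of_tendsto_of_sq_le (P := P) (C := Real.exp (2 * s * (m + 1)))
      (Z := fun n ω => stoppedExp l s ((m + 1 : ℝ≥0) / (n + 1) : ℝ≥0)
        (fun i => ξ ω + W' (i * ((m + 1 : ℝ≥0) / (n + 1))) ω) (n + 1))
      (fun n ω => (stoppedExp_pos _ _ _ _ _).le) (fun n => (hdm n).1) (fun n => (hdm n).2.2.1)
      (fun n => (hdm n).2.1) (fun n => ?_) (hle m) (hlim m)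
    -- The `n + 1` steps of length `(m + 1) / (n + 1)` always total `m + 1`, so the bound does not
    -- depend on `n`.
    refine (hdm n).2.2.2.trans_eq ?_
    congr 2
    push_cast
    field_simp
  have hfht : ∀ ω, firstHittingTime 0 ξ W ω = firstNegTime fun t => ξ ω + W t ω := by
    intro ω
    simp [firstHittingTime, firstNegTime]
  simp_rw [hfht]
  have ht : Filter.Tendsto
      (fun m : ℕ => ∫ ω, stoppedExpLimit l s (fun t => ξ ω + W t ω) (m + 1) ∂P) Filter.atTop
      (nhds (∫ ω, expNegMul s (firstNegTime fun t => ξ ω + W t ω) ∂P)) := by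
    refine tendsto_integral_of_dominated_convergence (fun _ => 1) (fun m => ?_)
      (integrable_const 1) (fun m => ?_) ?_
    -- Measurability is inherited from the grid approximations, so none is needed for the hitting
    -- time.
    · exact aestronglyMeasurable_of_tendsto_ae Filter.atTop
        (fun n : ℕ => (hdisc ((m + 1 : ℝ≥0) / (n + 1)) (n + 1)).1.aestronglyMeasurable) (hlim m)
    · filter_upwards [hle m] with ω h
      rwa [Real.norm_eq_abs, abs_of_nonneg]
      rw [stoppedExpLimit]
      split_ifs <;> positivity
    · filter_upwards [hpath] with ω h1
      exact tendsto_stoppedExpLimit h1.1 h1.2 hl hs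
  simp_rw [hval] at ht
  exact tendsto_nhds_unique ht tendsto_const_nhds

end Brownian

/-! ### The stable law of the starting point. -/

theorem corollary1 {Ω : Type*} [MeasurableSpace Ω] (P : Measure Ω) [IsProbabilityMeasure P]
    (W : ℝ≥0 → Ω → ℝ) (hW : IsBrownianReal W P)
    (ξ : Ω → ℝ) (hξ : Measurable ξ) (hξ_nonneg : ∀ᵐ ω ∂P, 0 ≤ ξ ω)
    (hindep : IndepFun ξ (fun ω t => W t ω) P)
    (c α : ℝ) (hc : 0 < c) (hα : 0 < α) (hα' : α < 1 / 2)
    (hτ : ∀ s : ℝ, 0 ≤ s →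
      ∫ ω, expNegMul s (firstHittingTime 0 ξ W ω) ∂P = Real.exp (-c * s ^ α)) :
    IsOneSidedStable (P.map ξ) (2 * α) ∧
      ∀ s : ℝ, 0 ≤ s →
        ∫ ω, Real.exp (-s * ξ ω) ∂P = Real.exp (-(c * (2 : ℝ) ^ (-α)) * s ^ (2 * α)) := by
  have hlap : ∀ s : ℝ, 0 ≤ s →
      ∫ ω, Real.exp (-s * ξ ω) ∂P = Real.exp (-(c * (2 : ℝ) ^ (-α)) * s ^ (2 * α)) := by
    intro s hs
    rcases hs.eq_or_lt with rfl | hs'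
    · simp [Real.zero_rpow (show 2 * α ≠ 0 by positivity)]
    -- The hitting-time transform is taken at `s ^ 2 / 2`, and `(s ^ 2 / 2) ^ α = 2 ^ (-α) s ^ (2
    -- α)`.
    · rw [← integral_expNegMul_firstHittingTime hW hξ hξ_nonneg hindep hs
        (show 0 < s ^ 2 / 2 by positivity) (by ring), hτ _ (by positivity),
        Real.div_rpow (by positivity) zero_le_two, Real.rpow_neg zero_le_two, ← Real.rpow_natCast,
        ← Real.rpow_mul hs]
      congr 1
      push_cast
      ring
  have := Measure.isProbabilityMeasure_map (μ := P) hξ.aemeasurable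
  refine ⟨isOneSidedStable_of_integral_exp_neg ?_ (C := c * (2 : ℝ) ^ (-α)) (by positivity)
    (by positivity) (by linarith) fun s hs => ?_, hlap⟩
  · rw [ae_map_iff hξ.aemeasurable measurableSet_Ici]
    exact hξ_nonneg
  · rw [integral_map hξ.aemeasurable (by fun_prop), hlap s hs]
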